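/- Let $W=(W_t)_{t\ge 0}$ be a standard one-dimensional Brownian motion (with $W_0=0$) on a probability space $(\Omega,\mathcal A,P)$, adapted to a filtration $(\mathcal F_t)_{t\ge 0}$, and let $f:\mathbb R\to\mathbb R$ be a function. Martingales are understood with respect to $(\mathcal F_t)_{t\ge0}$. (a) If $f$ is Lebesgue measurable and the process $(f(W_t))_{t\ge 0}$ is a martingale, then $f$ coincides with an affine function almost everywhere with respect to Lebesgue measure: there are $a,b\in\mathbb R$ such that $f(x)=ax+b$ for almost every $x\in\mathbb R$. (b) If $(f(W_t))_{t\ge 0}$ is a martingale whose paths are almost surely continuous, or almost surely right-continuous, then $f$ is affine: there are $a,b\in\mathbb R$ such that $f(x)=ax+b$ for every $x\in\mathbb R$. -/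

import Mathlib

open MeasureTheory ProbabilityTheory
open scoped NNReal

open Filter Topology

/-! Testing the martingale property on events that depend only on the Brownian value at time 1 makes
`f` invariant, up to null sets, under convolution with every centred Gaussian. Such a convolution is
continuous, so `f` has a continuous version `h` for which the invariance is exact at every point.
For fixed `x`, the second difference `h (x + z) + h (x - z) - 2 * h x` is even in `z` and integrates
to zero against all centred Gaussians; Weierstrass approximation in the variable `exp (-z ^ 2)`
forces it to vanish, so `h` is affine.

For (b), paths cross every level with positive probability. This transfers right-continuity of the
paths to continuity of `f`, which removes the exceptional null set. -/

/-- If `f ∘ c` is right-continuous along a continuous path `c` that crosses the level `x` upwards,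
then `f` is right-continuous at `x`. -/
lemma continuousWithinAt_Ioi_of_path_crossing {f : ℝ → ℝ} {c : ℝ≥0 → ℝ} (hc : Continuous c)
    (hfc : ∀ t, ContinuousWithinAt (fun s ↦ f (c s)) (Set.Ioi t) t) {x : ℝ} {s t : ℝ≥0}
    (hst : s ≤ t) (hs : c s ≤ x) (ht : x < c t) : ContinuousWithinAt f (Set.Ioi x) x := by
  have hK : IsCompact (Set.Icc s t ∩ c ⁻¹' {x}) :=
    isCompact_Icc.inter_right (isClosed_singleton.preimage hc)
  have hne : (Set.Icc s t ∩ c ⁻¹' {x}).Nonempty := by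
    obtain ⟨u, hu, hux⟩ := intermediate_value_Icc hst hc.continuousOn ⟨hs, ht.le⟩
    exact ⟨u, hu, hux⟩
  -- `τ` is the last visit to `x` before `t`. Afterwards the path stays above `x`, so on each short
  -- interval after `τ` it sweeps out a right neighbourhood of `x`.
  obtain ⟨τ, ⟨hτ, hcτ : c τ = x⟩, hmax⟩ := hK.exists_isGreatest hne
  have hτt : τ < t := hτ.2.lt_of_ne (by rintro rfl; exact ht.ne' hcτ)
  have hgt : ∀ u, τ < u → u ≤ t → x < c u := by
    intro u hu hut
    by_contra! hle
    obtain ⟨w, hw, hwx⟩ := intermediate_value_Icc hut hc.continuousOn ⟨hle, ht.le⟩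
    exact (hu.trans_le hw.1).not_ge (hmax ⟨⟨hτ.1.trans (hu.le.trans hw.1), hw.2⟩, hwx⟩)
  intro U hU
  have hU' : (fun s ↦ f (c s)) ⁻¹' U ∈ 𝓝[>] τ := hfc τ (by simpa [hcτ] using hU)
  obtain ⟨e, he, hsub⟩ := (mem_nhdsGT_iff_exists_Ioo_subset).1 hU'
  obtain ⟨u, hτu, hu⟩ := exists_between (lt_min (Set.mem_Ioi.1 he) hτt)
  have hut : u ≤ t := (hu.trans_le (min_le_right _ _)).le
  change f ⁻¹' U ∈ 𝓝[>] x
  refine mem_of_superset (Ioo_mem_nhdsGT (hgt u hτu hut)) fun y hy ↦ ?_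
  obtain ⟨w, hw, rfl⟩ := intermediate_value_Ioo hτu.le hc.continuousOn
    (show y ∈ Set.Ioo (c τ) (c u) by simpa [hcτ] using hy)
  exact hsub ⟨hw.1, hw.2.trans (hu.trans_le (min_le_left _ _))⟩

lemma gaussianReal_ne_zero_of_isOpen {m : ℝ} {v : ℝ≥0} (hv : v ≠ 0) {U : Set ℝ} (hU : IsOpen U)
    (hne : U.Nonempty) : gaussianReal m v U ≠ 0 := fun h ↦
  (hU.measure_pos volume hne).ne' (gaussianReal_absolutelyContinuous' m hv h)

/-! ### Brownian motion: level crossings and heat invariance -/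

section BrownianMotion

variable {Ω : Type*} [mΩ : MeasurableSpace Ω] {P : Measure Ω}
  {W : ℝ≥0 → Ω → ℝ} {f g : ℝ → ℝ}

lemma ProbabilityTheory.IsPreBrownianReal.hasLaw_increment (hW : IsPreBrownianReal W P)
    (s r : ℝ≥0) : HasLaw (W (s + r) - W s) (gaussianReal 0 r) P := by
  have h : nndist (s + r).1 s.1 = r := by
    ext
    change dist ((s + r : ℝ≥0) : ℝ) (s : ℝ) = r
    simp
  have := hW.hasLaw_sub (s + r) s
  rwa [h] at this

lemma ProbabilityTheory.IsPreBrownianReal.indepFun_increment (hW : IsPreBrownianReal W P)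
    (s r : ℝ≥0) : IndepFun (W s) (W (s + r) - W s) P :=
  hW.hasIndepIncrements.indepFun_eval_sub (zero_le) (le_self_add) hW.eval_zero_ae_eq_zero

/-- From `(x - 1, x)`, an independent increment larger than 1 ends above `x`. -/
lemma ProbabilityTheory.IsPreBrownianReal.measure_crossing_ne_zero (hW : IsPreBrownianReal W P)
    (x : ℝ) : P {ω | W 1 ω < x ∧ x < W (1 + 1) ω} ≠ 0 := by
  have h := (hW.indepFun_increment 1 1).measure_inter_preimage_eq_mul (Set.Ioo (x - 1) x)
    (Set.Ioi 1) measurableSet_Ioo measurableSet_Ioi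
  have h1 : P (W 1 ⁻¹' Set.Ioo (x - 1) x) ≠ 0 := by
    rw [← Measure.map_apply_of_aemeasurable (hW.aemeasurable 1) measurableSet_Ioo,
      (hW.hasLaw_eval 1).map_eq]
    exact gaussianReal_ne_zero_of_isOpen one_ne_zero isOpen_Ioo (Set.nonempty_Ioo.2 (by linarith))
  have h2 : P ((W (1 + 1) - W 1) ⁻¹' Set.Ioi 1) ≠ 0 := by
    rw [← Measure.map_apply_of_aemeasurable (hW.hasLaw_increment 1 1).aemeasurable
      measurableSet_Ioi, (hW.hasLaw_increment 1 1).map_eq]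
    exact gaussianReal_ne_zero_of_isOpen one_ne_zero isOpen_Ioi Set.nonempty_Ioi
  refine fun h0 ↦ mul_ne_zero h1 h2 (h ▸ measure_mono_null (fun ω hω ↦ ?_) h0)
  obtain ⟨⟨h3, h4⟩, h5⟩ := hω
  have h5 : 1 < W (1 + 1) ω - W 1 ω := h5
  exact ⟨h4, by linarith⟩

lemma ProbabilityTheory.IsBrownianReal.continuousWithinAt_Ioi (hW : IsBrownianReal W P)
    (hf : ∀ᵐ ω ∂P, ∀ t, ContinuousWithinAt (fun s ↦ f (W s ω)) (Set.Ioi t) t) (x : ℝ) :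
    ContinuousWithinAt f (Set.Ioi x) x := by
  obtain ⟨ω, hω, hc, hfc⟩ :=
    ((frequently_ae_iff.2 (hW.measure_crossing_ne_zero x)).and_eventually (hW.cont.and hf)).exists
  exact continuousWithinAt_Ioi_of_path_crossing hc hfc le_self_add hω.1.le hω.2

/-- A function is continuous as soon as its composition with a Brownian motion has almost surely
right-continuous paths. -/
lemma ProbabilityTheory.IsBrownianReal.continuous_of_rightContinuous (hW : IsBrownianReal W P)
    (hf : ∀ᵐ ω ∂P, ∀ t, ContinuousWithinAt (fun s ↦ f (W s ω)) (Set.Ioi t) t) :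
    Continuous f := by
  refine continuous_iff_continuousAt.2 fun x ↦
    continuousAt_iff_continuous_left'_right'.2 ⟨?_, hW.continuousWithinAt_Ioi hf x⟩
  -- Left limits reduce to right limits because `-W` is again a Brownian motion.
  have h := hW.neg.continuousWithinAt_Ioi (f := fun y ↦ f (-y)) (by simpa using hf) (-x)
  have h2 := ContinuousWithinAt.comp (x := x) (s := Set.Iio x) (f := fun y : ℝ ↦ -y) h
    continuous_neg.continuousWithinAt fun y hy ↦ Set.mem_Ioi.2 (neg_lt_neg (Set.mem_Iio.1 hy))
  simpa [Function.comp_def] using h2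

/-- If `f ∘ W` is a martingale, a Borel version `g` of `f` is invariant under the heat
semigroup. -/
lemma ProbabilityTheory.IsPreBrownianReal.heat_invariant [IsProbabilityMeasure P]
    {ℱ : Filtration ℝ≥0 mΩ} (hW : IsPreBrownianReal W P) (hWℱ : Adapted ℱ W)
    (hf : Martingale (fun t ω ↦ f (W t ω)) ℱ P) (hg : Measurable g) (hfg : f =ᵐ[volume] g) :
    (∀ v : ℝ≥0, v ≠ 0 → Integrable g (gaussianReal 0 v)) ∧
    ∀ r : ℝ≥0, r ≠ 0 → ∀ᵐ x, ∫ y, g (x + y) ∂(gaussianReal 0 r) = g x := by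
  -- Time 0 is excluded: the law of `W 0` is a Dirac mass, which may charge the null set where `f`
  -- and `g` differ.
  have hae : ∀ t : ℝ≥0, t ≠ 0 → (fun ω ↦ f (W t ω)) =ᵐ[P] fun ω ↦ g (W t ω) := by
    intro t ht
    have h1 : ∀ᵐ x ∂(P.map (W t)), f x = g x := by
      rw [(hW.hasLaw_eval t).map_eq]
      exact (gaussianReal_absolutelyContinuous 0 ht).ae_le hfg
    exact ae_of_ae_map (hW.aemeasurable t) h1
  have hint : ∀ t : ℝ≥0, t ≠ 0 → Integrable (fun ω ↦ g (W t ω)) P := fun t ht ↦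
    (hf.integrable t).congr (hae t ht)
  have hgint : ∀ v : ℝ≥0, v ≠ 0 → Integrable g (gaussianReal 0 v) := by
    intro v hv
    rw [← (hW.hasLaw_eval v).map_eq,
      integrable_map_measure hg.aestronglyMeasurable (hW.aemeasurable v)]
    exact hint v hv
  refine ⟨hgint, fun r hr ↦ ?_⟩
  have hr1 : 1 + r ≠ 0 := by positivity
  have hlaw : P.map (fun ω ↦ (W 1 ω, (W (1 + r) - W 1) ω))
      = (gaussianReal 0 1).prod (gaussianReal 0 r) := by
    rw [(indepFun_iff_map_prod_eq_prod_map_map (hW.aemeasurable 1)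
      (hW.hasLaw_increment 1 r).aemeasurable).1 (hW.indepFun_increment 1 r),
      (hW.hasLaw_eval 1).map_eq, (hW.hasLaw_increment 1 r).map_eq]
  have hpm : AEMeasurable (fun ω ↦ (W 1 ω, (W (1 + r) - W 1) ω)) P :=
    (hW.aemeasurable 1).prodMk (hW.hasLaw_increment 1 r).aemeasurable
  have hG : Measurable fun p : ℝ × ℝ ↦ g (p.1 + p.2) := by fun_prop
  have hGint : Integrable (fun p : ℝ × ℝ ↦ g (p.1 + p.2))
      ((gaussianReal 0 1).prod (gaussianReal 0 r)) := by
    rw [← hlaw, integrable_map_measure hG.aestronglyMeasurable hpm]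
    simpa [Function.comp_def] using hint (1 + r) hr1
  refine (gaussianReal_absolutelyContinuous' 0 (one_ne_zero (α := ℝ≥0))).ae_le ?_
  refine Integrable.ae_eq_of_forall_setIntegral_eq _ _ hGint.integral_prod_left
    (hgint 1 one_ne_zero) fun A hA _ ↦ ?_
  -- Only events `W 1 ⁻¹' A` are tested, so independence of the increment from `W 1` suffices;
  -- independence from the whole of `ℱ 1` is not needed.
  have h1 := hf.setIntegral_eq (i := 1) (j := 1 + r) le_self_add (hWℱ 1 hA)
  have hWm : ∀ t, Measurable (W t) := fun t ↦ (hWℱ t).mono (ℱ.le t) le_rfl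
  rw [setIntegral_congr_ae (hWm 1 hA) ((hae 1 one_ne_zero).mono fun _ h _ ↦ h),
    setIntegral_congr_ae (hWm 1 hA) ((hae (1 + r) hr1).mono fun _ h _ ↦ h)] at h1
  calc ∫ x in A, ∫ y, g (x + y) ∂(gaussianReal 0 r) ∂(gaussianReal 0 1)
      = ∫ p in A ×ˢ Set.univ, g (p.1 + p.2) ∂((gaussianReal 0 1).prod (gaussianReal 0 r)) := by
        rw [setIntegral_prod _ hGint.integrableOn]
        simp
    _ = ∫ ω in W 1 ⁻¹' A, g (W (1 + r) ω) ∂P := by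
        rw [← hlaw, setIntegral_map (hA.prod .univ) hG.aestronglyMeasurable hpm]
        simp [Set.preimage, Set.mem_prod]
    _ = ∫ ω in W 1 ⁻¹' A, g (W 1 ω) ∂P := h1.symm
    _ = ∫ x in A, g x ∂(gaussianReal 0 1) := by
        rw [← (hW.hasLaw_eval 1).map_eq, setIntegral_map hA hg.aestronglyMeasurable
          (hW.aemeasurable 1)]

end BrownianMotion

/-! ### Even functions with vanishing Gaussian integrals; midpoint-affine functions -/

/-- A continuous even function all of whose Gaussian integrals vanish is zero. -/
lemma eq_zero_of_forall_integral_mul_exp_eq_zero {G : ℝ → ℝ} (hG : Continuous G)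
    (heven : ∀ z, G (-z) = G z)
    (hint : ∀ l : ℝ, 0 < l → Integrable fun z ↦ G z * Real.exp (-l * z ^ 2))
    (hzero : ∀ l : ℝ, 0 < l → ∫ z, G z * Real.exp (-l * z ^ 2) = 0) (z₀ : ℝ) : G z₀ = 0 := by
  -- One Gaussian factor is kept in `F` for integrability; powers of `exp (-z ^ 2)` then only shift
  -- the parameter `l` from 1 to `n + 1`.
  set F : ℝ → ℝ := fun z ↦ G z * Real.exp (-1 * z ^ 2) with hF
  have hFint : Integrable F := hint 1 one_pos
  have hE : ∀ z : ℝ, Real.exp (-z ^ 2) ∈ Set.Icc (0 : ℝ) 1 := fun z ↦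
    ⟨(Real.exp_pos _).le, Real.exp_le_one_iff.2 (by nlinarith [sq_nonneg z])⟩
  have hpow : ∀ n : ℕ, ∀ z, F z * Real.exp (-z ^ 2) ^ n = G z * Real.exp (-(n + 1) * z ^ 2) := by
    intro n z
    rw [hF, ← Real.exp_nat_mul, mul_assoc, ← Real.exp_add]
    ring_nf
  have hpoly : ∀ p : Polynomial ℝ, Integrable (fun z ↦ F z * p.eval (Real.exp (-z ^ 2))) ∧
      ∫ z, F z * p.eval (Real.exp (-z ^ 2)) = 0 := by
    intro p
    have hterm : ∀ n : ℕ, Integrable (fun z ↦ p.coeff n * (F z * Real.exp (-z ^ 2) ^ n)) := by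
      intro n
      simp_rw [hpow]
      exact (hint _ (by positivity)).const_mul _
    have heq : (fun z ↦ F z * p.eval (Real.exp (-z ^ 2))) = fun z ↦
        ∑ n ∈ Finset.range (p.natDegree + 1), p.coeff n * (F z * Real.exp (-z ^ 2) ^ n) := by
      ext z
      rw [Polynomial.eval_eq_sum_range, Finset.mul_sum]
      exact Finset.sum_congr rfl fun _ _ ↦ by ring
    rw [heq]
    refine ⟨integrable_finsetSum _ fun n _ ↦ hterm n, ?_⟩
    rw [integral_finsetSum _ fun n _ ↦ hterm n]
    refine Finset.sum_eq_zero fun n _ ↦ ?_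
    simp_rw [hpow]
    rw [integral_const_mul, hzero _ (by positivity), mul_zero]
  have hcontE : Continuous fun z : ℝ ↦ Real.exp (-z ^ 2) := by fun_prop
  have hφint : ∀ φ : ℝ → ℝ, Continuous φ →
      Integrable (fun z ↦ F z * φ (Real.exp (-z ^ 2))) := by
    intro φ hφ
    obtain ⟨C, hC⟩ := isCompact_Icc.exists_bound_of_continuousOn
      (hφ.continuousOn (s := Set.Icc (0 : ℝ) 1))
    exact hFint.mul_bdd (hφ.comp hcontE).aestronglyMeasurable (ae_of_all _ fun z ↦ hC _ (hE z))
  have hφzero : ∀ φ : ℝ → ℝ, Continuous φ → ∫ z, F z * φ (Real.exp (-z ^ 2)) = 0 := by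
    intro φ hφ
    have hbd : ∀ ε : ℝ, 0 < ε → ‖∫ z, F z * φ (Real.exp (-z ^ 2))‖ ≤ (∫ z, ‖F z‖) * ε := by
      intro ε hε
      obtain ⟨p, hp⟩ := exists_polynomial_near_of_continuousOn 0 1 φ hφ.continuousOn ε hε
      have h1 : ∫ z, F z * φ (Real.exp (-z ^ 2)) =
          ∫ z, F z * (φ (Real.exp (-z ^ 2)) - p.eval (Real.exp (-z ^ 2))) := by
        simp_rw [mul_sub]
        rw [integral_sub (hφint φ hφ) (hpoly p).1, (hpoly p).2, sub_zero]
      rw [h1, ← integral_mul_const]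
      refine norm_integral_le_of_norm_le (hFint.norm.mul_const ε) (ae_of_all _ fun z ↦ ?_)
      rw [norm_mul]
      gcongr
      rw [Real.norm_eq_abs, abs_sub_comm]
      exact (hp _ (hE z)).le
    have hlim : Tendsto (fun ε : ℝ ↦ (∫ z, ‖F z‖) * ε) (𝓝[>] 0) (𝓝 0) := by
      have : Continuous fun ε : ℝ ↦ (∫ z, ‖F z‖) * ε := by fun_prop
      simpa using (this.tendsto 0).mono_left nhdsWithin_le_nhds
    exact norm_le_zero_iff.1 (ge_of_tendsto hlim (eventually_nhdsWithin_of_forall hbd))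
  -- test against a bump function of `exp (-z ^ 2)` around `exp (-z₀ ^ 2)`
  by_contra hne
  -- Evenness lets `G` be written as a function of `exp (-z ^ 2)`.
  set ψ : ℝ → ℝ := fun u ↦ G (√(-Real.log u)) with hψ
  have hψE : ∀ z, ψ (Real.exp (-z ^ 2)) = G z := by
    intro z
    simp only [hψ, Real.log_exp, neg_neg, Real.sqrt_sq_eq_abs]
    rcases abs_choice z with h | h <;> rw [h]
    exact heven z
  have hψc : ContinuousAt ψ (Real.exp (-z₀ ^ 2)) :=
    hG.continuousAt.comp (Real.continuous_sqrt.continuousAt.comp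
      (Real.continuousAt_log (Real.exp_pos _).ne').neg)
  have hpos : ∀ᶠ u in 𝓝 (Real.exp (-z₀ ^ 2)), 0 < ψ u * G z₀ := by
    refine (hψc.mul continuousAt_const).eventually (lt_mem_nhds ?_)
    change 0 < ψ (Real.exp (-z₀ ^ 2)) * G z₀
    rw [hψE]
    exact mul_self_pos.2 hne
  obtain ⟨δ, hδ, hball⟩ := Metric.eventually_nhds_iff.1 hpos
  -- The factor `G z₀` gives the bump the sign that `ψ` has on its support, so that the integrand is
  -- nonnegative.
  set φ : ℝ → ℝ := fun u ↦ max 0 (δ - dist u (Real.exp (-z₀ ^ 2))) * G z₀ with hφd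
  have hφ : Continuous φ := by fun_prop
  have hnn : ∀ z, 0 ≤ F z * φ (Real.exp (-z ^ 2)) := by
    intro z
    have : F z * φ (Real.exp (-z ^ 2)) = Real.exp (-1 * z ^ 2) *
        (max 0 (δ - dist (Real.exp (-z ^ 2)) (Real.exp (-z₀ ^ 2))) * (G z * G z₀)) := by
      simp only [hF, hφd]; ring
    rw [this]
    refine mul_nonneg (Real.exp_pos _).le ?_
    rcases lt_or_ge (dist (Real.exp (-z ^ 2)) (Real.exp (-z₀ ^ 2))) δ with h | h
    · have := hball h
      rw [hψE] at this
      positivity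
    · rw [max_eq_left (by linarith), zero_mul]
  have hae := (integral_eq_zero_iff_of_nonneg hnn (hφint φ hφ)).1 (hφzero φ hφ)
  have hc : Continuous fun z ↦ F z * φ (Real.exp (-z ^ 2)) := by
    simp only [hF]
    fun_prop
  have h0 := congrFun ((hc.ae_eq_iff_eq volume continuous_const).1 hae) z₀
  simp only [hF, hφd, dist_self, sub_zero, max_eq_right hδ.le] at h0
  exact mul_ne_zero (mul_ne_zero hne (Real.exp_ne_zero _)) (mul_ne_zero hδ.ne' hne) h0

lemma exists_eq_mul_add_of_add_eq_two_mul {h : ℝ → ℝ} (hc : Continuous h)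
    (hmid : ∀ x z, h (x + z) + h (x - z) = 2 * h x) : ∃ a b : ℝ, ∀ x, h x = a * x + b := by
  have hadd : ∀ x y, h (x + y) - h 0 = (h x - h 0) + (h y - h 0) := by
    intro x y
    -- The pairs `x + y, 0` and `x, y` have the same midpoint.
    have h1 := hmid ((x + y) / 2) ((x + y) / 2)
    have h2 := hmid ((x + y) / 2) ((x - y) / 2)
    ring_nf at h1 h2 ⊢
    linarith
  let φ : ℝ →+ ℝ := AddMonoidHom.mk' (fun x ↦ h x - h 0) hadd
  have hφ : Continuous φ := hc.sub continuous_const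
  refine ⟨h 1 - h 0, h 0, fun x ↦ ?_⟩
  have := (φ.toRealLinearMap hφ).map_smul x 1
  simp only [smul_eq_mul, mul_one, AddMonoidHom.coe_toRealLinearMap] at this
  change h x - h 0 = x * (h 1 - h 0) at this
  linarith

/-! ### Gaussian smoothing and its invariant functions -/

section Gaussian

variable {g : ℝ → ℝ}

lemma integrable_mul_exp_of_integrable_gaussianReal
    (hg : ∀ v : ℝ≥0, v ≠ 0 → Integrable g (gaussianReal 0 v)) {l : ℝ} (hl : 0 < l) :
    Integrable fun y ↦ g y * Real.exp (-l * y ^ 2) := by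
  have hv : (1 / (2 * l)).toNNReal ≠ 0 := (Real.toNNReal_pos.2 (by positivity)).ne'
  have hvl : ((1 / (2 * l)).toNNReal : ℝ) = 1 / (2 * l) := Real.coe_toNNReal _ (by positivity)
  have h := hg _ hv
  rw [gaussianReal_of_var_ne_zero _ hv, integrable_withDensity_iff_integrable_smul'
    (measurable_gaussianPDF _ _) (ae_of_all _ fun _ ↦ gaussianPDF_lt_top)] at h
  have h2 := h.const_mul (√(2 * Real.pi * (1 / (2 * l))))
  refine h2.congr (ae_of_all _ fun y ↦ ?_)
  simp only [toReal_gaussianPDF, gaussianPDFReal, smul_eq_mul, hvl, sub_zero]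
  have hs : √(2 * Real.pi * (1 / (2 * l))) ≠ 0 := by positivity
  have he : -y ^ 2 / (2 * (1 / (2 * l))) = -l * y ^ 2 := by field_simp
  rw [he, ← mul_assoc, ← mul_assoc, mul_inv_cancel₀ hs, one_mul, mul_comm]

lemma integral_gaussianReal_eq_integral_mul_exp {l : ℝ} (hl : 0 < l) :
    ∫ y, g y ∂(gaussianReal 0 (1 / (2 * l)).toNNReal) =
      (√(Real.pi / l))⁻¹ * ∫ y, g y * Real.exp (-l * y ^ 2) := by
  have hv : (1 / (2 * l)).toNNReal ≠ 0 := (Real.toNNReal_pos.2 (by positivity)).ne'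
  have hvl : ((1 / (2 * l)).toNNReal : ℝ) = 1 / (2 * l) := Real.coe_toNNReal _ (by positivity)
  rw [integral_gaussianReal_eq_integral_smul hv, ← integral_const_mul]
  congr 1 with y
  simp only [gaussianPDFReal, smul_eq_mul, hvl, sub_zero]
  have he : -y ^ 2 / (2 * (1 / (2 * l))) = -l * y ^ 2 := by field_simp
  have hs : 2 * Real.pi * (1 / (2 * l)) = Real.pi / l := by field_simp
  rw [he, hs]
  ring

/-- Gives domination uniform in `|x| ≤ R`. The exponents differ by `l / 2 * (y - 2 * x) ^ 2 + l * (R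
^ 2 - x ^ 2)`, which is nonnegative. -/
lemma norm_mul_exp_sub_sq_le (y : ℝ) {l x R : ℝ} (hl : 0 < l) (hx : |x| ≤ R) :
    ‖g y * Real.exp (-l * (y - x) ^ 2)‖ ≤
      Real.exp (l * R ^ 2) * ‖g y * Real.exp (-(l / 2) * y ^ 2)‖ := by
  rw [norm_mul, norm_mul, Real.norm_of_nonneg (Real.exp_pos _).le,
    Real.norm_of_nonneg (Real.exp_pos _).le, mul_left_comm, ← Real.exp_add]
  gcongr
  have h1 : x ^ 2 ≤ R ^ 2 := by rw [← sq_abs]; gcongr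
  nlinarith [mul_nonneg hl.le (sq_nonneg (y - 2 * x)), mul_le_mul_of_nonneg_left h1 hl.le]

lemma integrable_mul_exp_sub_sq (hgm : AEStronglyMeasurable g)
    (hg : ∀ l : ℝ, 0 < l → Integrable fun y ↦ g y * Real.exp (-l * y ^ 2)) {l : ℝ} (hl : 0 < l)
    (x : ℝ) : Integrable fun y ↦ g y * Real.exp (-l * (y - x) ^ 2) :=
  ((hg (l / 2) (by positivity)).norm.const_mul _).mono'
    (hgm.mul (by fun_prop : Continuous fun y ↦
      Real.exp (-l * (y - x) ^ 2)).aestronglyMeasurable)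
    (ae_of_all _ fun y ↦ norm_mul_exp_sub_sq_le y hl le_rfl)

lemma continuous_integral_mul_exp_sub_sq (hgm : AEStronglyMeasurable g)
    (hg : ∀ l : ℝ, 0 < l → Integrable fun y ↦ g y * Real.exp (-l * y ^ 2)) {l : ℝ} (hl : 0 < l) :
    Continuous fun x ↦ ∫ y, g y * Real.exp (-l * (y - x) ^ 2) := by
  refine continuous_iff_continuousAt.2 fun x₀ ↦ ?_
  refine continuousAt_of_dominated
    (bound := fun y ↦ Real.exp (l * (|x₀| + 1) ^ 2) * ‖g y * Real.exp (-(l / 2) * y ^ 2)‖)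
    (.of_forall fun x ↦ (integrable_mul_exp_sub_sq hgm hg hl x).aestronglyMeasurable) ?_
    ((hg (l / 2) (by positivity)).norm.const_mul _)
    (ae_of_all _ fun y ↦ by fun_prop)
  filter_upwards [Metric.ball_mem_nhds x₀ one_pos] with x hx
  refine ae_of_all _ fun y ↦ norm_mul_exp_sub_sq_le y hl ?_
  rw [Metric.mem_ball, Real.dist_eq] at hx
  linarith [abs_sub_abs_le_abs_sub x x₀]

/-- A measurable function invariant under the heat semigroup is affine almost everywhere. -/
lemma ae_affine_of_heat_invariant (hgm : Measurable g)
    (hg : ∀ v : ℝ≥0, v ≠ 0 → Integrable g (gaussianReal 0 v))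
    (hinv : ∀ r : ℝ≥0, r ≠ 0 → ∀ᵐ x, ∫ y, g (x + y) ∂(gaussianReal 0 r) = g x) :
    ∃ a b : ℝ, ∀ᵐ x, g x = a * x + b := by
  have hexp := fun l hl ↦ integrable_mul_exp_of_integrable_gaussianReal hg (l := l) hl
  have hcont := fun l hl ↦
    continuous_integral_mul_exp_sub_sq hgm.aestronglyMeasurable hexp (l := l) hl
  have hconv : ∀ l : ℝ, 0 < l →
      ∀ᵐ x, (√(Real.pi / l))⁻¹ * ∫ y, g y * Real.exp (-l * (y - x) ^ 2) = g x := by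
    intro l hl
    have hv : (1 / (2 * l)).toNNReal ≠ 0 := (Real.toNNReal_pos.2 (by positivity)).ne'
    filter_upwards [hinv _ hv] with x hx
    rw [integral_gaussianReal_eq_integral_mul_exp (g := fun y ↦ g (x + y)) hl] at hx
    rw [← hx, ← integral_add_left_eq_self _ x]
    simp
  set h : ℝ → ℝ := fun x ↦ (√(Real.pi / 1))⁻¹ * ∫ y, g y * Real.exp (-1 * (y - x) ^ 2) with hh
  have hhc : Continuous h := (hcont 1 one_pos).const_mul _
  have hgh : ∀ᵐ x, h x = g x := hconv 1 one_pos
  -- Both sides are continuous in `x`, so almost everywhere equality becomes equality everywhere.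
  have hall : ∀ l : ℝ, 0 < l → ∀ x,
      ∫ y, h y * Real.exp (-l * (y - x) ^ 2) = √(Real.pi / l) * h x := by
    intro l hl x
    have h1 : (fun x ↦ (√(Real.pi / l))⁻¹ * ∫ y, g y * Real.exp (-l * (y - x) ^ 2)) =ᵐ[volume] h := by
      filter_upwards [hconv l hl, hgh] with x h1 h2 using h1.trans h2.symm
    have h2 := congrFun ((((hcont l hl).const_mul _).ae_eq_iff_eq volume hhc).1 h1) x
    have hs : √(Real.pi / l) ≠ 0 := by positivity
    rw [← h2, mul_inv_cancel_left₀ hs]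
    exact integral_congr_ae (hgh.mono fun y hy ↦ by simp only [hy])
  have hhexp : ∀ l : ℝ, 0 < l → Integrable fun y ↦ h y * Real.exp (-l * y ^ 2) := fun l hl ↦
    (hexp l hl).congr (hgh.mono fun y hy ↦ by simp only [hy])
  have hshift : ∀ l : ℝ, 0 < l → ∀ x, Integrable (fun z ↦ h (x + z) * Real.exp (-l * z ^ 2)) ∧
      ∫ z, h (x + z) * Real.exp (-l * z ^ 2) = √(Real.pi / l) * h x := by
    intro l hl x
    constructor
    · simpa using (integrable_mul_exp_sub_sq hhc.aestronglyMeasurable hhexp hl x).comp_add_left x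
    · rw [← hall l hl x,
        ← integral_add_left_eq_self (fun y ↦ h y * Real.exp (-l * (y - x) ^ 2)) x]
      simp
  have hneg : ∀ l : ℝ, 0 < l → ∀ x, Integrable (fun z ↦ h (x - z) * Real.exp (-l * z ^ 2)) ∧
      ∫ z, h (x - z) * Real.exp (-l * z ^ 2) = √(Real.pi / l) * h x := by
    intro l hl x
    constructor
    · simpa [sub_eq_add_neg] using (hshift l hl x).1.comp_neg
    · rw [← (hshift l hl x).2, ← integral_neg_eq_self]
      simp [sub_eq_add_neg]
  have hmid : ∀ x z, h (x + z) + h (x - z) = 2 * h x := by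
    intro x z
    have hsum : ∀ l : ℝ, (fun z ↦ (h (x + z) + h (x - z) - 2 * h x) * Real.exp (-l * z ^ 2)) =
        fun z ↦ h (x + z) * Real.exp (-l * z ^ 2) + h (x - z) * Real.exp (-l * z ^ 2) -
          2 * h x * Real.exp (-l * z ^ 2) := fun l ↦ by ext z; ring
    refine sub_eq_zero.1 (eq_zero_of_forall_integral_mul_exp_eq_zero
      (G := fun z ↦ h (x + z) + h (x - z) - 2 * h x) (by fun_prop) (fun z ↦ ?_)
      (fun l hl ↦ ?_) (fun l hl ↦ ?_) z)
    · simp only [sub_neg_eq_add, ← sub_eq_add_neg]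
      ring
    · rw [hsum]
      exact ((hshift l hl x).1.add (hneg l hl x).1).sub
        ((integrable_exp_neg_mul_sq hl).const_mul _)
    · rw [hsum, integral_sub (f := fun z ↦ h (x + z) * Real.exp (-l * z ^ 2) +
          h (x - z) * Real.exp (-l * z ^ 2)) ((hshift l hl x).1.add (hneg l hl x).1)
        ((integrable_exp_neg_mul_sq hl).const_mul _),
        integral_add (hshift l hl x).1 (hneg l hl x).1, (hshift l hl x).2, (hneg l hl x).2,
        integral_const_mul, integral_gaussian]
      ring
  obtain ⟨a, b, hab⟩ := exists_eq_mul_add_of_add_eq_two_mul hhc hmid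
  exact ⟨a, b, hgh.mono fun x hx ↦ by rw [← hx, hab]⟩

end Gaussian

theorem corollary2 {Ω : Type*} [mΩ : MeasurableSpace Ω] (P : Measure Ω) [IsProbabilityMeasure P]
    (ℱ : Filtration ℝ≥0 mΩ) (W : ℝ≥0 → Ω → ℝ) (hW : IsBrownianReal W P) (hWℱ : Adapted ℱ W)
    (f : ℝ → ℝ) :
    -- measurable `f`, no path regularity: `f` is affine almost everywhere
    (AEMeasurable f volume → Martingale (fun t ω ↦ f (W t ω)) ℱ P →
      ∃ a b : ℝ, ∀ᵐ x ∂(volume : Measure ℝ), f x = a * x + b) ∧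
    -- arbitrary `f`, almost surely continuous or right-continuous paths: `f` is affine
    (Martingale (fun t ω ↦ f (W t ω)) ℱ P →
      ((∀ᵐ ω ∂P, Continuous fun t ↦ f (W t ω)) ∨
        (∀ᵐ ω ∂P, ∀ t, ContinuousWithinAt (fun s ↦ f (W s ω)) (Set.Ioi t) t)) →
      ∃ a b : ℝ, ∀ x, f x = a * x + b) := by
  have hA : AEMeasurable f volume → Martingale (fun t ω ↦ f (W t ω)) ℱ P →
      ∃ a b : ℝ, ∀ᵐ x ∂(volume : Measure ℝ), f x = a * x + b := by
    intro hf hM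
    obtain ⟨hint, hinv⟩ := hW.heat_invariant hWℱ hM hf.measurable_mk hf.ae_eq_mk
    obtain ⟨a, b, hab⟩ := ae_affine_of_heat_invariant hf.measurable_mk hint hinv
    refine ⟨a, b, ?_⟩
    filter_upwards [hf.ae_eq_mk, hab] with x h1 h2 using h1.trans h2
  refine ⟨hA, fun hM hpath ↦ ?_⟩
  have hright : ∀ᵐ ω ∂P, ∀ t, ContinuousWithinAt (fun s ↦ f (W s ω)) (Set.Ioi t) t := by
    rcases hpath with h | h
    · exact h.mono fun ω hω t ↦ hω.continuousWithinAt
    · exact h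
  have hfc : Continuous f := hW.continuous_of_rightContinuous hright
  obtain ⟨a, b, hab⟩ := hA hfc.aemeasurable hM
  exact ⟨a, b, fun x ↦ congrFun ((hfc.ae_eq_iff_eq volume
    (by fun_prop : Continuous fun x : ℝ ↦ a * x + b)).1 hab) x⟩
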